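/- Let $\mathbb H$ be a real or complex Hilbert space and let $A\neq 0$ be a positive (self-adjoint) bounded operator on $\mathbb H$. Write $\langle x,y\rangle_A=\langle Ax,y\rangle$ and $\|x\|_A=\sqrt{\langle x,x\rangle_A}$. A bounded operator $S$ on $\mathbb H$ is called $A$-bounded if there is $c>0$ with $\|Sx\|_A\le c\|x\|_A$ for all $x\in\mathbb H$; in that case $\|S\|_A=\sup\{\|Sx\|_A:\|x\|_A=1\}$. For $A$-bounded $T,S$ write $T\perp_A^B S$ if $\|T+\lambda S\|_A\ge\|T\|_A$ for all scalars $\lambda$. An $A$-bounded operator $T$ is called $A$-smooth if $\|T\|_A\ne 0$ and, for all $A$-bounded operators $S_1,S_2$, $T\perp_A^B S_1$ and $T\perp_A^B S_2$ imply $T\perp_A^B (S_1+S_2)$. A bounded operator $T$ is called $A$-compact if for every sequence $(x_n)$ with $\sup_n\|x_n\|_A<\infty$ the sequence $(Tx_n)$ has a subsequence $(Tx_{n_k})$ such that $\|Tx_{n_k}-y\|_A\to 0$ for some $y\in\mathbb H$. Let $T$ be a bounded operator on $\mathbb H$ with $R(T^*A)\subseteq R(A)$, where $R(\cdot)$ denotes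 the range, and let $T^\sharp$ be the unique bounded operator on $\mathbb H$ that satisfies $\langle Tx,y\rangle_A=\langle x,T^\sharp y\rangle_A$ for all $x,y\in\mathbb H$ and $R(T^\sharp)\subseteq\overline{R(A)}$. Suppose that $T$ is $A$-compact and that $R(A)$ is closed. Then $T$ is $A$-smooth if and only if $T^\sharp$ is $A$-smooth. -/

import Mathlib

open Filter Topology

namespace SemiHilbert

variable {𝕜 H : Type*} [RCLike 𝕜] [NormedAddCommGroup H] [InnerProductSpace 𝕜 H]

/-- The semi-inner product `⟨x, y⟩_A = ⟨A x, y⟩` (in Mathlib's convention, linear in `y`). -/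
noncomputable def aInner (A : H →L[𝕜] H) (x y : H) : 𝕜 := inner 𝕜 (A x) y

/-- The seminorm `‖x‖_A = √⟨x, x⟩_A`. -/
noncomputable def aSeminorm (A : H →L[𝕜] H) (x : H) : ℝ := √(RCLike.re (aInner A x x))

/-- `T` is `A`-bounded: `‖T x‖_A ≤ c ‖x‖_A` for all `x`, for some `c > 0`. -/
def ABounded (A T : H →L[𝕜] H) : Prop :=
  ∃ c : ℝ, 0 < c ∧ ∀ x : H, aSeminorm A (T x) ≤ c * aSeminorm A x

/-- The operator seminorm `‖T‖_A = sup {‖T x‖_A : ‖x‖_A = 1}` of an `A`-bounded operator. -/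
noncomputable def aOpNorm (A T : H →L[𝕜] H) : ℝ :=
  sSup {r : ℝ | ∃ x : H, aSeminorm A x = 1 ∧ r = aSeminorm A (T x)}

/-- `A`-Birkhoff–James orthogonality of `T` to `S`. -/
def ABirkhoffJames (A T S : H →L[𝕜] H) : Prop :=
  ∀ z : 𝕜, aOpNorm A T ≤ aOpNorm A (T + z • S)

/-- `T` is `A`-smooth: it is `A`-bounded, `‖T‖_A ≠ 0`, and `A`-Birkhoff–James orthogonality is
right additive at `T` within the `A`-bounded operators. -/
def ASmooth (A T : H →L[𝕜] H) : Prop :=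
  ABounded A T ∧ aOpNorm A T ≠ 0 ∧
    ∀ S₁ S₂ : H →L[𝕜] H, ABounded A S₁ → ABounded A S₂ →
      ABirkhoffJames A T S₁ → ABirkhoffJames A T S₂ → ABirkhoffJames A T (S₁ + S₂)

/-- `T` is `A`-compact: for every `‖·‖_A`-bounded sequence `x`, the sequence `T (x n)` has a
subsequence that converges with respect to `‖·‖_A`. -/
def ACompact (A T : H →L[𝕜] H) : Prop :=
  ∀ x : ℕ → H, (∃ C : ℝ, ∀ n, aSeminorm A (x n) ≤ C) →
    ∃ φ : ℕ → ℕ, StrictMono φ ∧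
      ∃ y : H, Tendsto (fun n => aSeminorm A (T (x (φ n)) - y)) atTop (𝓝 0)

/-- `W` is an `A`-adjoint of `T`: `⟨T x, y⟩_A = ⟨x, W y⟩_A` for all `x`, `y`. -/
def IsAAdjoint (A T W : H →L[𝕜] H) : Prop :=
  ∀ x y : H, aInner A (T x) y = aInner A x (W y)

/-- The class `𝔹_A(H)` of bounded operators `T` with `R(T* A) ⊆ R(A)`. -/
def BA [CompleteSpace H] (A : H →L[𝕜] H) : Set (H →L[𝕜] H) :=
  {T | Set.range (ContinuousLinearMap.adjoint T ∘L A) ⊆ Set.range A}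

/-- For positive `A` and `T ∈ 𝔹_A(H)` there is exactly one `A`-adjoint of `T` whose range is
contained in the closure of `R(A)`. -/
theorem existsUnique_isAAdjoint [CompleteSpace H] {A T : H →L[𝕜] H} (hA : A.IsPositive)
    (hT : T ∈ BA A) :
    ∃! W : H →L[𝕜] H, IsAAdjoint A T W ∧ Set.range W ⊆ closure (Set.range A) := by
  have hsa : ContinuousLinearMap.adjoint A = A := hA.isSelfAdjoint.adjoint_eq
  have hker : (A.kerᗮ : Set H) = closure (Set.range A) := by
    rw [A.orthogonal_ker, hsa]
    rw [Submodule.topologicalClosure_coe]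
    rfl
  have hsym : ∀ x y : H, inner 𝕜 (A x) y = inner 𝕜 x (A y) := fun x y => by
    conv_lhs => rw [← hsa]
    exact ContinuousLinearMap.adjoint_inner_left A y x
  -- being an `A`-adjoint means `A W = T* A`
  have hadj : ∀ W : H →L[𝕜] H,
      IsAAdjoint A T W ↔ ∀ y, A (W y) = ContinuousLinearMap.adjoint T (A y) := by
    intro W
    constructor
    · intro h y
      refine ext_inner_left 𝕜 fun x => ?_
      rw [← hsym, ContinuousLinearMap.adjoint_inner_right, ← hsym]
      exact (h x y).symm
    · intro h x y
      unfold aInner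
      rw [hsym, hsym, h, ContinuousLinearMap.adjoint_inner_right]
  have hinj : ∀ u ∈ A.kerᗮ, ∀ v ∈ A.kerᗮ, A u = A v → u = v := by
    intro u hu v hv h
    have h1 : u - v ∈ A.kerᗮ := Submodule.sub_mem _ hu hv
    have h2 : u - v ∈ A.ker := by simp [LinearMap.mem_ker, h]
    have h3 : inner 𝕜 (u - v) (u - v) = 0 := (Submodule.mem_orthogonal _ _).1 h1 _ h2
    exact sub_eq_zero.1 (inner_self_eq_zero.1 h3)
  have hex : ∀ x : H, ∃ y ∈ A.kerᗮ, A y = ContinuousLinearMap.adjoint T (A x) := by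
    intro x
    obtain ⟨y, hy⟩ := hT ⟨x, rfl⟩
    have : CompleteSpace A.ker := A.isClosed_ker.completeSpace_coe
    refine ⟨y - A.ker.starProjection y, Submodule.sub_starProjection_mem_orthogonal y, ?_⟩
    have h0 : A (A.ker.starProjection y) = 0 := Submodule.starProjection_apply_mem A.ker y
    rw [map_sub, h0, sub_zero, hy]
    rfl
  choose f hf1 hf2 using hex
  let L : H →ₗ[𝕜] H :=
    { toFun := f
      map_add' := fun x y => hinj _ (hf1 _) _ (Submodule.add_mem _ (hf1 _) (hf1 _)) (by
        simp [hf2])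
      map_smul' := fun c x => hinj _ (hf1 _) _ (Submodule.smul_mem _ _ (hf1 _)) (by
        simp [hf2]) }
  have hL : ∀ (u : ℕ → H) (x y : H), Tendsto u atTop (𝓝 x) →
      Tendsto (L ∘ u) atTop (𝓝 y) → y = L x := by
    intro u x y hu hLu
    refine hinj _ ?_ _ (hf1 x) ?_
    · exact (Submodule.isClosed_orthogonal A.ker).mem_of_tendsto hLu
        (Eventually.of_forall fun n => hf1 (u n))
    · have h1 : Tendsto (fun n => A (L (u n))) atTop (𝓝 (A y)) :=
        (A.continuous.tendsto y).comp hLu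
      have h2 : Tendsto (fun n => ContinuousLinearMap.adjoint T (A (u n))) atTop
          (𝓝 (ContinuousLinearMap.adjoint T (A x))) :=
        (((ContinuousLinearMap.adjoint T).continuous.comp A.continuous).tendsto x).comp hu
      have h3 : (fun n => A (L (u n))) = fun n => ContinuousLinearMap.adjoint T (A (u n)) :=
        funext fun n => hf2 (u n)
      rw [h3] at h1
      exact (tendsto_nhds_unique h1 h2).trans (hf2 x).symm
  refine ⟨⟨L, L.continuous_of_seq_closed_graph (fun u x y hu h => hL u x y hu h)⟩, ⟨?_, ?_⟩, ?_⟩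
  · exact (hadj _).2 fun y => hf2 y
  · rintro _ ⟨x, rfl⟩
    rw [← hker]
    exact hf1 x
  · rintro W ⟨hW1, hW2⟩
    ext x
    refine hinj _ ?_ _ (hf1 x) ?_
    · have : W x ∈ (A.kerᗮ : Set H) := by
        rw [hker]
        exact hW2 ⟨x, rfl⟩
      exact this
    · exact ((hadj W).1 hW1 x).trans (hf2 x).symm

/-- `T^♯`: the unique `A`-adjoint of `T ∈ 𝔹_A(H)` with range in the closure of `R(A)`. -/
noncomputable def aAdjoint [CompleteSpace H] (A T : H →L[𝕜] H) (hA : A.IsPositive)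
    (hT : T ∈ BA A) : H →L[𝕜] H :=
  (existsUnique_isAAdjoint hA hT).choose

theorem aAdjoint_spec [CompleteSpace H] {A T : H →L[𝕜] H} (hA : A.IsPositive) (hT : T ∈ BA A) :
    IsAAdjoint A T (aAdjoint A T hA hT) ∧
      Set.range (aAdjoint A T hA hT) ⊆ closure (Set.range A) :=
  (existsUnique_isAAdjoint hA hT).choose_spec.1

end SemiHilbert

namespace SemiHilbert

variable {𝕜 H : Type*} [RCLike 𝕜] [NormedAddCommGroup H] [InnerProductSpace 𝕜 H]

/-! Being an `A`-adjoint is a symmetric relation, additive and conjugate-homogeneous, and it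
preserves the operator seminorm (`IsAAdjoint.aOpNorm_eq`); hence it preserves Birkhoff–James
orthogonality. Closedness of `R(A)` gives every `A`-bounded operator an `A`-adjoint
(`ABounded.mem_BA`), so right additivity at an operator transfers to each of its `A`-adjoints. By
symmetry this gives both implications. -/

theorem aInner_conj_symm {A : H →L[𝕜] H} (hA : A.IsPositive) (x y : H) :
    starRingEnd 𝕜 (aInner A y x) = aInner A x y := by
  unfold aInner
  rw [inner_conj_symm]
  exact (hA.isSymmetric x y).symm

/-- The semi-inner product `⟨·, ·⟩_A` as a pre-inner product space structure. -/
noncomputable abbrev aCore {A : H →L[𝕜] H} (hA : A.IsPositive) : PreInnerProductSpace.Core 𝕜 H where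
  inner := aInner A
  conj_inner_symm := aInner_conj_symm hA
  re_inner_nonneg x := hA.re_inner_nonneg_left x
  add_left x y z := by simp [aInner, inner_add_left]
  smul_left x y r := by simp [aInner, inner_smul_left]

theorem aSeminorm_nonneg (A : H →L[𝕜] H) (x : H) : 0 ≤ aSeminorm A x := Real.sqrt_nonneg _

theorem aSeminorm_sq {A : H →L[𝕜] H} (hA : A.IsPositive) (x : H) :
    aSeminorm A x ^ 2 = RCLike.re (aInner A x x) :=
  Real.sq_sqrt (hA.re_inner_nonneg_left x)

/-- Cauchy–Schwarz inequality for `⟨·, ·⟩_A`. -/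
theorem norm_aInner_le {A : H →L[𝕜] H} (hA : A.IsPositive) (x y : H) :
    ‖aInner A x y‖ ≤ aSeminorm A x * aSeminorm A y :=
  letI := aCore hA
  InnerProductSpace.Core.norm_inner_le_norm (𝕜 := 𝕜) x y

theorem aSeminorm_add_le {A : H →L[𝕜] H} (hA : A.IsPositive) (x y : H) :
    aSeminorm A (x + y) ≤ aSeminorm A x + aSeminorm A y :=
  letI := aCore hA
  letI := InnerProductSpace.Core.toSeminormedAddCommGroup (𝕜 := 𝕜) (F := H)
  norm_add_le x y

theorem aSeminorm_smul {A : H →L[𝕜] H} (hA : A.IsPositive) (c : 𝕜) (x : H) :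
    aSeminorm A (c • x) = ‖c‖ * aSeminorm A x := by
  have h : aInner A (c • x) (c • x) = ((‖c‖ ^ 2 : ℝ) : 𝕜) * aInner A x x := by
    simp only [aInner, map_smul, inner_smul_left, inner_smul_right]
    rw [← mul_assoc, RCLike.mul_conj, RCLike.ofReal_pow]
  refine (sq_eq_sq₀ (aSeminorm_nonneg A _)
    (mul_nonneg (norm_nonneg c) (aSeminorm_nonneg A x))).1 ?_
  rw [mul_pow, aSeminorm_sq hA, aSeminorm_sq hA, h, RCLike.re_ofReal_mul]

theorem aSeminorm_eq_zero_iff {A : H →L[𝕜] H} (hA : A.IsPositive) (x : H) :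
    aSeminorm A x = 0 ↔ A x = 0 := by
  constructor
  · intro h
    -- Cauchy–Schwarz against `A x`, since `⟨x, A x⟩_A = ‖A x‖²`.
    have h1 := norm_aInner_le hA x (A x)
    rw [h, zero_mul, norm_le_zero_iff] at h1
    exact inner_self_eq_zero.1 h1
  · intro h
    simp [aSeminorm, aInner, h]

theorem ABounded.add {A T S : H →L[𝕜] H} (hA : A.IsPositive) (hT : ABounded A T)
    (hS : ABounded A S) : ABounded A (T + S) := by
  obtain ⟨c, hc, hcT⟩ := hT
  obtain ⟨d, hd, hdS⟩ := hS
  refine ⟨c + d, add_pos hc hd, fun x => ?_⟩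
  have := aSeminorm_add_le hA (T x) (S x)
  rw [add_mul]
  exact this.trans (add_le_add (hcT x) (hdS x))

theorem ABounded.smul {A S : H →L[𝕜] H} (hA : A.IsPositive) (z : 𝕜) (hS : ABounded A S) :
    ABounded A (z • S) := by
  obtain ⟨d, hd, hdS⟩ := hS
  refine ⟨(‖z‖ + 1) * d, by positivity, fun x => ?_⟩
  rw [smul_apply, aSeminorm_smul hA, mul_assoc]
  exact mul_le_mul (by linarith) (hdS x) (aSeminorm_nonneg A _) (by positivity)

theorem ABounded.aSeminorm_apply_le {A T : H →L[𝕜] H} (hA : A.IsPositive) (hT : ABounded A T)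
    (x : H) : aSeminorm A (T x) ≤ aOpNorm A T * aSeminorm A x := by
  obtain ⟨c, hc, hcT⟩ := hT
  -- Null vectors cannot be normalised, but `A`-boundedness sends them to null vectors.
  rcases eq_or_ne (aSeminorm A x) 0 with hx | hx
  · simpa [hx] using hcT x
  have hx0 : 0 < aSeminorm A x := lt_of_le_of_ne (aSeminorm_nonneg A x) hx.symm
  have hn : ‖(((aSeminorm A x)⁻¹ : ℝ) : 𝕜)‖ = (aSeminorm A x)⁻¹ := by
    rw [RCLike.norm_ofReal, abs_of_pos (inv_pos.2 hx0)]
  rw [← div_le_iff₀ hx0]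
  refine le_csSup ⟨c, ?_⟩ ⟨(((aSeminorm A x)⁻¹ : ℝ) : 𝕜) • x, ?_, ?_⟩
  · rintro _ ⟨y, hy, rfl⟩
    simpa [hy] using hcT y
  · rw [aSeminorm_smul hA, hn, inv_mul_cancel₀ hx]
  · rw [map_smul, aSeminorm_smul hA, hn, div_eq_inv_mul]

theorem aOpNorm_nonneg (A T : H →L[𝕜] H) : 0 ≤ aOpNorm A T := by
  refine Real.sSup_nonneg ?_
  rintro _ ⟨x, -, rfl⟩
  exact aSeminorm_nonneg A _

/-- The condition `0 ≤ c` covers an empty unit sphere, where `sSup ∅ = 0`. -/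
theorem aOpNorm_le {A T : H →L[𝕜] H} {c : ℝ} (hc : 0 ≤ c)
    (h : ∀ x, aSeminorm A (T x) ≤ c * aSeminorm A x) : aOpNorm A T ≤ c := by
  refine Real.sSup_le ?_ hc
  rintro _ ⟨x, hx, rfl⟩
  simpa [hx] using h x

theorem IsAAdjoint.symm {A T W : H →L[𝕜] H} (hA : A.IsPositive) (h : IsAAdjoint A T W) :
    IsAAdjoint A W T := fun x y => by
  rw [← aInner_conj_symm hA, ← h, aInner_conj_symm hA]

theorem IsAAdjoint.add {A T W S V : H →L[𝕜] H} (hTW : IsAAdjoint A T W)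
    (hSV : IsAAdjoint A S V) : IsAAdjoint A (T + S) (W + V) := fun x y => by
  have h1 := hTW x y
  have h2 := hSV x y
  simp only [aInner] at h1 h2 ⊢
  simp [inner_add_left, inner_add_right, h1, h2]

theorem IsAAdjoint.smul {A S V : H →L[𝕜] H} (z : 𝕜) (h : IsAAdjoint A S V) :
    IsAAdjoint A (z • S) (starRingEnd 𝕜 z • V) := fun x y => by
  have h1 := h x y
  simp only [aInner] at h1 ⊢
  simp [inner_smul_left, inner_smul_right, h1]

/-- Every bound of an operator with respect to `‖·‖_A` is a bound of its `A`-adjoints. -/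
theorem IsAAdjoint.aSeminorm_apply_le {A T W : H →L[𝕜] H} (hA : A.IsPositive)
    (h : IsAAdjoint A T W) {c : ℝ} (hc : 0 ≤ c)
    (hT : ∀ x, aSeminorm A (T x) ≤ c * aSeminorm A x) (y : H) :
    aSeminorm A (W y) ≤ c * aSeminorm A y := by
  rcases eq_or_ne (aSeminorm A (W y)) 0 with h0 | h0
  · rw [h0]
    exact mul_nonneg hc (aSeminorm_nonneg A y)
  have hpos : 0 < aSeminorm A (W y) := lt_of_le_of_ne (aSeminorm_nonneg A _) h0.symm
  refine le_of_mul_le_mul_left ?_ hpos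
  -- The adjoint relation is tested at `x = W y`.
  calc aSeminorm A (W y) * aSeminorm A (W y) = RCLike.re (aInner A (T (W y)) y) := by
        rw [← sq, aSeminorm_sq hA, h]
    _ ≤ ‖aInner A (T (W y)) y‖ := RCLike.re_le_norm _
    _ ≤ aSeminorm A (T (W y)) * aSeminorm A y := norm_aInner_le hA _ _
    _ ≤ c * aSeminorm A (W y) * aSeminorm A y :=
        mul_le_mul_of_nonneg_right (hT _) (aSeminorm_nonneg A y)
    _ = aSeminorm A (W y) * (c * aSeminorm A y) := by ring

theorem IsAAdjoint.aBounded {A T W : H →L[𝕜] H} (hA : A.IsPositive) (h : IsAAdjoint A T W)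
    (hT : ABounded A T) : ABounded A W := by
  obtain ⟨c, hc, hcT⟩ := hT
  exact ⟨c, hc, h.aSeminorm_apply_le hA hc.le hcT⟩

theorem IsAAdjoint.aOpNorm_le {A T W : H →L[𝕜] H} (hA : A.IsPositive) (h : IsAAdjoint A T W)
    (hT : ABounded A T) : aOpNorm A W ≤ aOpNorm A T :=
  SemiHilbert.aOpNorm_le (aOpNorm_nonneg A T)
    (h.aSeminorm_apply_le hA (aOpNorm_nonneg A T) (hT.aSeminorm_apply_le hA))

theorem IsAAdjoint.aOpNorm_eq {A T W : H →L[𝕜] H} (hA : A.IsPositive) (h : IsAAdjoint A T W)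
    (hT : ABounded A T) : aOpNorm A W = aOpNorm A T :=
  le_antisymm (h.aOpNorm_le hA hT) ((h.symm hA).aOpNorm_le hA (h.aBounded hA hT))

/-- Passing to `A`-adjoints preserves `A`-Birkhoff–James orthogonality. -/
theorem ABirkhoffJames.of_isAAdjoint {A T W S V : H →L[𝕜] H} (hA : A.IsPositive)
    (hTW : IsAAdjoint A T W) (hSV : IsAAdjoint A S V) (hT : ABounded A T) (hS : ABounded A S)
    (h : ABirkhoffJames A T S) : ABirkhoffJames A W V := fun z => by
  -- `W + z • V` is an `A`-adjoint of `T + conj z • S`, and `conj z` also ranges over all scalars.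
  have h1 := (hTW.add (hSV.smul (starRingEnd 𝕜 z))).aOpNorm_eq hA (hT.add hA (hS.smul hA _))
  rw [RCLike.conj_conj] at h1
  rw [h1, hTW.aOpNorm_eq hA hT]
  exact h _

variable [CompleteSpace H]

/-- If `A` has closed range, then every `A`-bounded operator belongs to `𝔹_A(H)`. -/
theorem ABounded.mem_BA {A S : H →L[𝕜] H} (hA : A.IsPositive) (hR : IsClosed (Set.range A))
    (hS : ABounded A S) : S ∈ BA A := by
  rintro _ ⟨y, rfl⟩
  have hsa : ContinuousLinearMap.adjoint A = A := hA.isSelfAdjoint.adjoint_eq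
  have hker : (A.kerᗮ : Set H) = Set.range A := by
    rw [A.orthogonal_ker, hsa, Submodule.topologicalClosure_coe]
    exact hR.closure_eq
  -- Since `R(A) = (ker A)ᗮ`, it suffices that `S` maps `ker A`, the null space of the seminorm,
  -- into itself: then `⟨x, S* A y⟩ = ⟨A S x, y⟩ = 0` for `x ∈ ker A`.
  rw [← hker, SetLike.mem_coe, Submodule.mem_orthogonal]
  intro x hx
  obtain ⟨c, -, hc⟩ := hS
  have hx0 : aSeminorm A x = 0 := (aSeminorm_eq_zero_iff hA x).2 hx
  have hSx : aSeminorm A (S x) = 0 :=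
    le_antisymm (by simpa [hx0] using hc x) (aSeminorm_nonneg A _)
  have hASx : A (S x) = 0 := (aSeminorm_eq_zero_iff hA _).1 hSx
  rw [ContinuousLinearMap.comp_apply, ContinuousLinearMap.adjoint_inner_right]
  have h1 : inner 𝕜 (A (S x)) y = inner 𝕜 (S x) (A y) := hA.isSymmetric (S x) y
  rw [← h1, hASx, inner_zero_left]

theorem ASmooth.of_isAAdjoint {A T W : H →L[𝕜] H} (hA : A.IsPositive)
    (hR : IsClosed (Set.range A)) (h : IsAAdjoint A T W) (hT : ASmooth A T) : ASmooth A W := by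
  obtain ⟨hTb, hT0, hadd⟩ := hT
  have hWb := h.aBounded hA hTb
  refine ⟨hWb, by rwa [h.aOpNorm_eq hA hTb], fun S₁ S₂ hS₁ hS₂ h₁ h₂ => ?_⟩
  obtain ⟨V₁, ⟨hV₁, -⟩, -⟩ := existsUnique_isAAdjoint hA (hS₁.mem_BA hA hR)
  obtain ⟨V₂, ⟨hV₂, -⟩, -⟩ := existsUnique_isAAdjoint hA (hS₂.mem_BA hA hR)
  have hVb₁ := hV₁.aBounded hA hS₁
  have hVb₂ := hV₂.aBounded hA hS₂
  have hW := h.symm hA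
  -- Orthogonality moves from `W` to `T`, is added there, and moves back.
  exact (hadd V₁ V₂ hVb₁ hVb₂ (h₁.of_isAAdjoint hA hW hV₁ hWb hS₁)
    (h₂.of_isAAdjoint hA hW hV₂ hWb hS₂)).of_isAAdjoint hA h
      ((hV₁.symm hA).add (hV₂.symm hA)) hTb (hVb₁.add hA hVb₂)

end SemiHilbert

theorem mainTheorem8 {𝕜 H : Type*} [RCLike 𝕜] [NormedAddCommGroup H] [InnerProductSpace 𝕜 H]
    [CompleteSpace H] (A T : H →L[𝕜] H) (hA : A.IsPositive) (hA0 : A ≠ 0)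
    (hT : T ∈ SemiHilbert.BA A) (hTc : SemiHilbert.ACompact A T)
    (hR : IsClosed (Set.range A)) :
    SemiHilbert.ASmooth A T ↔ SemiHilbert.ASmooth A (SemiHilbert.aAdjoint A T hA hT) := by
  have h := (SemiHilbert.aAdjoint_spec hA hT).1
  -- `T` is an `A`-adjoint of `T^♯` even if `(T^♯)^♯ ≠ T`, so only the adjoint relation is used, not
  -- the range condition.
  exact ⟨fun hs => hs.of_isAAdjoint hA hR h, fun hs => hs.of_isAAdjoint hA hR (h.symm hA)⟩
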